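/- Let $\overline{\mathbb Q}$ be an algebraic closure of $\mathbb Q$, and let $h:\overline{\mathbb Q}^{\times}\to[0,\infty)$ be the absolute logarithmic Weil height. Let $K_1,K_2,\dots,K_N$ be fields with $\mathbb Q\subseteq K_n\subseteq\overline{\mathbb Q}$ for each $n$, such that for each pair of indices $n_1\neq n_2$ at least one of the extensions $K_{n_1}/(K_{n_1}\cap K_{n_2})$ and $K_{n_2}/(K_{n_1}\cap K_{n_2})$ is a (possibly infinite) Galois extension. Let $$\Gamma=(K_1^{\times}K_2^{\times}\cdots K_N^{\times})^{\mathrm{div}}=\{\gamma\in\overline{\mathbb Q}^{\times} : \gamma^m\in K_1^{\times}K_2^{\times}\cdots K_N^{\times}\text{ for some } m\neq 0 \text{ in } \mathbb Z\},$$ and for $\alpha\in\overline{\mathbb Q}^{\times}$ put $h_\Gamma(\alpha)=\inf_{\gamma\in\Gamma}h(\alpha/\gamma)$. Then for every $\alpha\in\overline{\mathbb Q}^{\times}$, $h_\Gamma(\alpha)=0$ if and only if $\alpha\in\Gamma$. -/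

import Mathlib

/-- The absolute logarithmic Weil height on the nonzero elements of a field `Ω` that is algebraic
over `ℚ`: for `α` in a number field of degree `d`, it is `1 / d` times the sum over all places of
the number field of the positive part of the logarithm of the (local-degree normalized) absolute
value of `α`. Mathlib's notion takes the number field `ℚ(α)`. -/
noncomputable def weilHeight {Ω : Type*} [Field Ω] [CharZero Ω] (α : Ωˣ) : ℝ :=
  NumberField.absLogHeight₁ (α : Ω)

/-- The height relative to a subgroup `Γ`: the infimum of `h (α / γ)` over `γ` in `Γ`. -/
noncomputable def relHeight {Ω : Type*} [Field Ω] [CharZero Ω] (Γ : Subgroup Ωˣ) (α : Ωˣ) : ℝ :=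
  ⨅ γ : Γ, weilHeight (α / (γ : Ωˣ))

/-- The product `K₁ˣ K₂ˣ ⋯ K_Nˣ`, as a subgroup of `Ωˣ`. -/
def unitsProduct {Ω : Type*} [Field Ω] [CharZero Ω] {N : ℕ}
    (K : Fin N → IntermediateField ℚ Ω) : Subgroup Ωˣ where
  carrier := {u | ∃ β : Fin N → Ωˣ, (∀ n, (β n : Ω) ∈ K n) ∧ u = ∏ n, β n}
  one_mem' := ⟨1, fun n => by simp, by simp⟩
  mul_mem' := by
    rintro _ _ ⟨β, hβ, rfl⟩ ⟨δ, hδ, rfl⟩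
    refine ⟨β * δ, fun n => ?_, by simp [Finset.prod_mul_distrib]⟩
    simpa using mul_mem (hβ n) (hδ n)
  inv_mem' := by
    rintro _ ⟨β, hβ, rfl⟩
    refine ⟨β⁻¹, fun n => ?_, by simp⟩
    simpa using inv_mem (hβ n)

/-- The group `G^div` of all `γ` some nonzero integer power of which lies in `G`. -/
def divClosure {Ω : Type*} [Field Ω] (G : Subgroup Ωˣ) : Subgroup Ωˣ where
  carrier := {γ | ∃ m : ℤ, m ≠ 0 ∧ γ ^ m ∈ G}
  one_mem' := ⟨1, one_ne_zero, by simp⟩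
  mul_mem' := by
    rintro a b ⟨m, hm, ha⟩ ⟨k, hk, hb⟩
    refine ⟨m * k, mul_ne_zero hm hk, ?_⟩
    rw [mul_zpow, zpow_mul, mul_comm m k, zpow_mul]
    exact mul_mem (zpow_mem ha k) (zpow_mem hb m)
  inv_mem' := by
    rintro a ⟨m, hm, ha⟩
    exact ⟨m, hm, by simpa using ha⟩

/-- `K / (K ∩ L)` is a (possibly infinite) Galois extension. -/
def IsGaloisOverInter {Ω : Type*} [Field Ω] [CharZero Ω] (K L : IntermediateField ℚ Ω) : Prop :=
  IsGalois ↥(K ⊓ L) ↥(IntermediateField.extendScalars (inf_le_left : K ⊓ L ≤ K))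

/-!
Write `h` for the Weil height on `Ωˣ` and `G` for the Galois group of `Ω / ℚ`. Modulo torsion, and
after inverting integers, `Ωˣ` becomes a `ℚ`-vector space `V` on which `h` is a `G`-invariant norm:
it is homogeneous and subadditive, and vanishes only at roots of unity by Northcott's theorem. All
`G`-orbits on `V` are finite. If `H n` is the group of automorphisms that fix `K n`, then the Galois
correspondence identifies `Γ` with the elements whose class lies in the sum of the subspaces of
`H n`-invariants (`iSup_fixedPoints_fixingSubgroup`), and `relHeight Γ α = 0` says that the class of
`α` is in the closure of this sum. So the claim is that the sum is closed.

Averaging over `H n`-orbits is a projection `P n` of norm at most one onto the `H n`-invariants. If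
`K m` is Galois over `K m ∩ K n` then `H n` normalizes `H m`
(`IsGaloisOverInter.conj_mem_fixingSubgroup`), so elements of `H n` permute the `H m`-orbits and
`P m`, `P n` commute (`averageMap_commute`). For commuting bounded projections,
`1 - ∏ n, (1 - P n)` is a bounded projection onto the sum of their ranges, which is therefore
closed (`mem_iSup_of_approx_of_projections`).

The absolute height is defined through the field `ℚ(α)`, so that comparing heights of different
elements requires that it can be computed in any number field. This is `mulHeight₁_algebraMap`: the
finite part of the height is an ideal norm and the infinite part a product over complex embeddings,
and both are raised to the power `[L : K]` when `K` is extended to `L`.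
-/

open MulAction

/-! ### Averages over finite orbits -/

/-- The average of the orbit of `v` under `H`, for orbits that are finite; it is `0` for infinite
orbits. Working with orbits rather than with a finite quotient of `H` makes the average independent
of any choice of a level. -/
noncomputable def orbitAverage {V : Type*} [AddCommGroup V] [Module ℚ V] (H : Type*) [Group H]
    [DistribMulAction H V] (v : V) : V :=
  (Nat.card (orbit H v) : ℚ)⁻¹ • ∑ᶠ x : orbit H v, (x : V)

section Average

variable {V : Type*} [AddCommGroup V] [Module ℚ V] {H : Type*} [Group H] [DistribMulAction H V]

/-- The average of the orbit of `v` can be computed by averaging any equivariant map that takes the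
value `v`, over any finite transitive `H`-set: all fibres of such a map onto the orbit have the same
cardinality. This is the source of all the formal properties of `orbitAverage`. -/
theorem orbitAverage_eq_of_equivariant {X : Type*} [Fintype X] [MulAction H X] [IsPretransitive H X]
    (f : X → V) (hf : ∀ (h : H) x, f (h • x) = h • f x) (x₀ : X) :
    orbitAverage H (f x₀) = (Fintype.card X : ℚ)⁻¹ • ∑ x, f x := by
  classical
  have hmem : ∀ x, f x ∈ orbit H (f x₀) := fun x => by
    obtain ⟨h, rfl⟩ := exists_smul_eq H x₀ x
    exact ⟨h, (hf h x₀).symm⟩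
  let π : X → orbit H (f x₀) := fun x => ⟨f x, hmem x⟩
  have hsurj : Function.Surjective π := by
    rintro ⟨_, h, rfl⟩
    exact ⟨h • x₀, Subtype.ext (hf h x₀)⟩
  have : Finite (orbit H (f x₀)) := Finite.of_surjective π hsurj
  let : Fintype (orbit H (f x₀)) := Fintype.ofFinite _
  set c := Finset.card {x | π x = π x₀} with hc
  have hcard : ∀ y, Finset.card {x | π x = y} = c := by
    intro y
    obtain ⟨x, rfl⟩ := hsurj y
    obtain ⟨h, rfl⟩ := exists_smul_eq H x₀ x
    refine (Finset.card_bij (fun a _ => h • a) ?_ ?_ ?_).symm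
    · intro a ha
      simp only [Finset.mem_filter, Finset.mem_univ, true_and, π, Subtype.mk.injEq] at ha ⊢
      rw [hf, hf, ha]
    · intro a _ b _ hab
      exact smul_left_cancel h hab
    · intro b hb
      refine ⟨h⁻¹ • b, ?_, smul_inv_smul h b⟩
      simp only [Finset.mem_filter, Finset.mem_univ, true_and, π, Subtype.mk.injEq] at hb ⊢
      rw [hf, hb, hf, inv_smul_smul]
  have hsum : ∑ x, f x = (c : ℚ) • ∑ y : orbit H (f x₀), (y : V) := by
    rw [← Finset.sum_fiberwise (s := Finset.univ) (g := π), Finset.smul_sum]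
    refine Finset.sum_congr rfl fun y _ => ?_
    rw [Finset.sum_congr rfl (g := fun _ => (y : V)), Finset.sum_const, hcard,
      Nat.cast_smul_eq_nsmul]
    intro x hx
    simp only [Finset.mem_filter, Finset.mem_univ, true_and] at hx
    rw [← hx]
  have hX : Fintype.card X = c * Fintype.card (orbit H (f x₀)) := by
    rw [← Finset.card_univ, Finset.card_eq_sum_card_fiberwise (f := π) (t := Finset.univ)
      (by simp [Set.MapsTo])]
    simp [hcard, mul_comm]
  have hc0 : (c : ℚ) ≠ 0 := by
    have : 0 < c := Finset.card_pos.mpr ⟨x₀, by simp⟩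
    exact_mod_cast this.ne'
  rw [orbitAverage, finsum_eq_sum_of_fintype, hsum, hX, smul_smul, Nat.card_eq_fintype_card]
  congr 1
  push_cast
  field_simp

/-- The average of a fixed vector, by averaging a constant map on a one-point `H`-set. -/
theorem orbitAverage_eq_self {v : V} (hv : ∀ h : H, h • v = v) : orbitAverage H v = v := by
  let : MulAction H Unit := { smul := fun _ _ => (), one_smul := fun _ => rfl,
                               mul_smul := fun _ _ _ => rfl }
  have : IsPretransitive H Unit := ⟨fun _ _ => ⟨1, rfl⟩⟩
  simpa using orbitAverage_eq_of_equivariant (H := H) (fun _ : Unit => v)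
    (fun h _ => (hv h).symm) ()

theorem orbitAverage_smul_self (h : H) (v : V) : orbitAverage H (h • v) = orbitAverage H v := by
  unfold orbitAverage
  rw [orbit_eq_iff.mpr (mem_orbit v h)]

/-- An additive automorphism that maps `H`-orbits to `H`-orbits commutes with averaging. -/
theorem orbitAverage_smul_of_image_orbit {L : Type*} [Group L] [DistribMulAction L V] (g : L)
    (v : V)
    (hg : orbit H (g • v) = (g • ·) '' orbit H v) :
    orbitAverage H (g • v) = g • orbitAverage H v := by
  unfold orbitAverage
  rw [smul_comm]
  have h1 : Nat.card (orbit H (g • v)) = Nat.card (orbit H v) := by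
    rw [hg, Nat.card_image_of_injective (MulAction.injective g)]
  have h2 : ∑ᶠ x : orbit H (g • v), (x : V) = g • ∑ᶠ x : orbit H v, (x : V) := by
    let e : orbit H v ≃ orbit H (g • v) :=
      (Equiv.Set.image (g • ·) (orbit H v) (MulAction.injective g)).trans (Equiv.setCongr hg.symm)
    rw [← finsum_comp_equiv e]
    exact ((DistribMulAction.toAddEquiv V g).map_finsum _).symm
  rw [h1, h2]

theorem smul_orbitAverage (h : H) (v : V) : h • orbitAverage H v = orbitAverage H v := by
  rw [← orbitAverage_smul_of_image_orbit h v, orbitAverage_smul_self]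
  rw [Set.image_smul, smul_orbit, orbit_eq_iff.mpr (mem_orbit v h)]

theorem orbitAverage_add (hfin : ∀ v : V, Finite (orbit H v)) (v w : V) :
    orbitAverage H (v + w) = orbitAverage H v + orbitAverage H w := by
  -- The orbit of `(v, w)` maps equivariantly to the orbits of `v`, of `w` and of `v + w`.
  have : Finite (orbit H (v, w)) := by
    have := hfin v
    have := hfin w
    refine Finite.of_injective
      (fun p : orbit H (v, w) => ((⟨p.1.1, ?_⟩, ⟨p.1.2, ?_⟩) : orbit H v × orbit H w)) ?_
    · obtain ⟨_, h, rfl⟩ := p; exact ⟨h, rfl⟩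
    · obtain ⟨_, h, rfl⟩ := p; exact ⟨h, rfl⟩
    · rintro ⟨⟨a, b⟩, _⟩ ⟨⟨c, d⟩, _⟩ h
      simpa using h
  let : Fintype (orbit H (v, w)) := Fintype.ofFinite _
  let x₀ : orbit H (v, w) := ⟨(v, w), mem_orbit_self _⟩
  have h1 := orbitAverage_eq_of_equivariant (H := H) (fun p : orbit H (v, w) => p.1.1)
    (fun _ _ => rfl) x₀
  have h2 := orbitAverage_eq_of_equivariant (H := H) (fun p : orbit H (v, w) => p.1.2)
    (fun _ _ => rfl) x₀
  have h3 := orbitAverage_eq_of_equivariant (H := H) (fun p : orbit H (v, w) => p.1.1 + p.1.2)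
    (fun h p => (smul_add h p.1.1 p.1.2).symm) x₀
  change orbitAverage H v = _ at h1
  change orbitAverage H w = _ at h2
  change orbitAverage H (v + w) = _ at h3
  rw [h1, h2, h3, Finset.sum_add_distrib, smul_add]

/-- Averaging over `H`-orbits as a linear projection onto the `H`-invariants. -/
noncomputable def averageMap (hfin : ∀ v : V, Finite (orbit H v)) : V →ₗ[ℚ] V :=
  (AddMonoidHom.mk' (fun v : V => orbitAverage H v) (orbitAverage_add hfin)).toRatLinearMap

/-- If elements of `L` map `H`-orbits to `H`-orbits, then the two averaging projections commute. -/
theorem averageMap_commute {L : Type*} [Group L] [DistribMulAction L V]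
    (hH : ∀ v : V, Finite (orbit H v)) (hL : ∀ v : V, Finite (orbit L v))
    (hLH : ∀ (g : L) (v : V), orbit H (g • v) = (g • ·) '' orbit H v) :
    Commute (averageMap hH) (averageMap hL) := by
  refine LinearMap.ext fun v => ?_
  -- `orbitAverage H` is an `L`-equivariant map on the `L`-orbit of `v`.
  have := hL v
  let : Fintype (orbit L v) := Fintype.ofFinite _
  have h1 := orbitAverage_eq_of_equivariant (H := L) (fun p : orbit L v => p.1)
    (fun _ _ => rfl) ⟨v, mem_orbit_self v⟩
  have h2 := orbitAverage_eq_of_equivariant (H := L) (fun p : orbit L v => orbitAverage H p.1)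
    (fun g p => orbitAverage_smul_of_image_orbit g p.1 (hLH g p.1)) ⟨v, mem_orbit_self v⟩
  change orbitAverage L v = _ at h1
  change orbitAverage L (orbitAverage H v) = _ at h2
  change averageMap hH (orbitAverage L v) = orbitAverage L (orbitAverage H v)
  rw [h1, h2, map_smul, map_sum]
  rfl

/-- Averaging does not increase an invariant seminorm. -/
theorem seminorm_orbitAverage_le (N : Seminorm ℚ V) (hN : ∀ (h : H) (v : V), N (h • v) = N v)
    {v : V} (hfin : Finite (orbit H v)) : N (orbitAverage H v) ≤ N v := by
  let : Fintype (orbit H v) := Fintype.ofFinite _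
  have hpos : 0 < Fintype.card (orbit H v) := Fintype.card_pos_iff.mpr ⟨⟨v, mem_orbit_self v⟩⟩
  have hsum : N (∑ x : orbit H v, (x : V)) ≤ Fintype.card (orbit H v) * N v := by
    refine (Finset.le_sum_of_subadditive N (map_zero N).le (map_add_le_add N) _ _).trans ?_
    rw [← nsmul_eq_mul, ← Finset.card_univ]
    refine Finset.sum_le_card_nsmul _ _ _ fun x _ => ?_
    obtain ⟨_, h, rfl⟩ := x
    exact (hN h v).le
  rw [orbitAverage, finsum_eq_sum_of_fintype, map_smul_eq_mul, Nat.card_eq_fintype_card]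
  have : ‖((Fintype.card (orbit H v) : ℚ)⁻¹)‖ = (Fintype.card (orbit H v) : ℝ)⁻¹ := by
    rw [norm_inv, ← Rat.norm_cast_real]; simp
  rw [this, inv_mul_le_iff₀ (by exact_mod_cast hpos)]
  exact hsum

end Average

/-! ### Sums of spaces of invariants are closed -/

section Invariants

theorem orbit_smul_eq_image_of_normalizes {G V : Type*} [Group G] [MulAction G V]
    {H L : Subgroup G} (hLH : ∀ g ∈ L, ∀ h ∈ H, g * h * g⁻¹ ∈ H)
    (g : L) (v : V) : orbit H (g • v) = (g • ·) '' orbit H v := by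
  ext w
  constructor
  · rintro ⟨h, rfl⟩
    have := hLH g⁻¹ (inv_mem g.2) h h.2
    refine ⟨_, ⟨⟨_, this⟩, rfl⟩, ?_⟩
    simp only [Subgroup.smul_def, smul_smul]
    congr 1
    group
  · rintro ⟨_, ⟨h, rfl⟩, rfl⟩
    refine ⟨⟨_, hLH g g.2 h h.2⟩, ?_⟩
    simp only [Subgroup.smul_def, smul_smul]
    congr 1
    group

variable {V : Type*} [AddCommGroup V] [Module ℚ V] {G : Type*} [Group G] [DistribMulAction G V]

variable (V) in
/-- The `ℚ`-subspace of `H`-invariant vectors. -/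
def invariantSubspace (H : Subgroup G) : Submodule ℚ V where
  carrier := {v | ∀ h ∈ H, h • v = v}
  zero_mem' := fun h _ => smul_zero h
  add_mem' := fun hv hw h hh => by rw [smul_add, hv h hh, hw h hh]
  smul_mem' := fun q v hv h hh => by rw [smul_comm, hv h hh]

/-- The sum of the ranges of finitely many commuting norm-nonincreasing projections `P i` is closed:
`1 - ∏ i, (1 - P i)` is a bounded projection onto it. -/
theorem mem_iSup_of_approx_of_projections (N : Seminorm ℚ V) (hN0 : ∀ v, N v = 0 → v = 0)
    {ι : Type*} [Fintype ι] (S : ι → Submodule ℚ V) (P : ι → Module.End ℚ V)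
    (hP_mem : ∀ i v, P i v ∈ S i) (hP_self : ∀ i, ∀ v ∈ S i, P i v = v)
    (hP_comm : ∀ i j, Commute (P i) (P j)) (hP_le : ∀ i v, N (P i v) ≤ N v)
    (v : V) (hv : ∀ ε > 0, ∃ w ∈ ⨆ i, S i, N (v - w) < ε) :
    v ∈ ⨆ i, S i := by
  let D : List ι → Module.End ℚ V := fun l => (l.map fun i => 1 - P i).prod
  have hD_nil : ∀ v, D [] v = v := fun v => rfl
  have hD_cons : ∀ i l v, D (i :: l) v = D l v - P i (D l v) := fun i l v => by
    simp [D, LinearMap.sub_apply]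
  -- `1 - D l` takes values in the sum of the `S i`.
  have hD_sub : ∀ l v, v - D l v ∈ ⨆ i, S i := by
    intro l v
    induction l with
    | nil => rw [hD_nil, sub_self]; exact zero_mem _
    | cons i l ih =>
      rw [hD_cons, ← sub_add]
      exact add_mem ih (Submodule.mem_iSup_of_mem i (hP_mem i _))
  have hD_comm : ∀ i l, Commute (P i) (D l) := fun i l => by
    refine Commute.list_prod_right _ _ fun x hx => ?_
    obtain ⟨j, _, rfl⟩ := List.mem_map.mp hx
    exact (Commute.one_right _).sub_right (hP_comm i j)
  -- `D l` kills `S i` for every `i` in `l`.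
  have hD_zero : ∀ l, ∀ i ∈ l, ∀ w ∈ S i, D l w = 0 := by
    intro l
    induction l with
    | nil => simp
    | cons j l ih =>
      intro i hi w hw
      rw [hD_cons]
      obtain rfl | hi := List.mem_cons.mp hi
      · have : P i (D l w) = D l (P i w) := LinearMap.congr_fun (hD_comm i l) w
        rw [this, hP_self i w hw, sub_self]
      · rw [ih i hi w hw, map_zero, sub_zero]
  have hD_le : ∀ l v, N (D l v) ≤ 2 ^ l.length * N v := by
    intro l v
    induction l with
    | nil => rw [hD_nil]; simp
    | cons i l ih =>
      rw [hD_cons, List.length_cons, pow_succ']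
      have h1 : N (D l v - P i (D l v)) ≤ N (D l v) + N (P i (D l v)) := map_sub_le_add N _ _
      have h2 := hP_le i (D l v)
      linarith
  set l := (Finset.univ : Finset ι).toList
  have hker : ⨆ i, S i ≤ LinearMap.ker (D l) :=
    iSup_le fun i w hw => hD_zero l i (by simp [l]) w hw
  have hDv : D l v = 0 := by
    refine hN0 _ (le_antisymm (le_of_forall_pos_le_add fun ε hε => ?_) (apply_nonneg N _))
    obtain ⟨w, hw, hlt⟩ := hv (ε / 2 ^ l.length) (by positivity)
    have h1 : D l v = D l (v - w) := by rw [map_sub, LinearMap.mem_ker.mp (hker hw), sub_zero]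
    rw [h1, zero_add]
    refine (hD_le l _).trans ?_
    rw [lt_div_iff₀ (by positivity)] at hlt
    linarith
  simpa [hDv] using hD_sub l v

/-- Let `G` act on a normed `ℚ`-vector space with finite orbits, preserving the norm, and let
finitely many subgroups be given such that of each two of them one normalizes the other. Then the
sum of their spaces of invariants is closed. -/
theorem mem_iSup_invariantSubspace_of_approx (N : Seminorm ℚ V) (hN0 : ∀ v, N v = 0 → v = 0)
    (hN : ∀ (g : G) (v : V), N (g • v) = N v) (hfin : ∀ v : V, Finite (orbit G v))
    {ι : Type*} [Fintype ι] (H : ι → Subgroup G)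
    (hH : ∀ i j, i ≠ j → (∀ g ∈ H i, ∀ h ∈ H j, g * h * g⁻¹ ∈ H j) ∨
      (∀ g ∈ H j, ∀ h ∈ H i, g * h * g⁻¹ ∈ H i))
    (v : V) (hv : ∀ ε > 0, ∃ w ∈ ⨆ i, invariantSubspace V (H i), N (v - w) < ε) :
    v ∈ ⨆ i, invariantSubspace V (H i) := by
  have hfinH : ∀ i (v : V), Finite (orbit (H i) v) := fun i v => by
    have := hfin v
    exact Finite.Set.subset (orbit G v) (by rintro _ ⟨h, rfl⟩; exact ⟨(h : G), rfl⟩)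
  refine mem_iSup_of_approx_of_projections N hN0 _ (fun i => averageMap (hfinH i)) ?_ ?_ ?_ ?_ v hv
  · exact fun i v h hh => smul_orbitAverage (⟨h, hh⟩ : H i) v
  · exact fun i v hv => orbitAverage_eq_self fun h : H i => hv h h.2
  · intro i j
    obtain rfl | hij := eq_or_ne i j
    · exact Commute.refl _
    obtain h | h := hH i j hij
    · exact (averageMap_commute (hfinH j) (hfinH i) (orbit_smul_eq_image_of_normalizes h)).symm
    · exact averageMap_commute (hfinH i) (hfinH j) (orbit_smul_eq_image_of_normalizes h)
  · exact fun i v => seminorm_orbitAverage_le (H := H i) N (fun h v => hN (h : G) v) (hfinH i v)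

end Invariants

open NumberField Height

/-! ### Heights in extensions of number fields -/

section HeightExtension

variable (K L : Type*) [Field K] [NumberField K] [Field L] [NumberField L] [Algebra K L]

/-- For integral tuples the finite part of the height is the inverse of an ideal norm. -/
theorem finprod_finitePlace_algebraMap {ι : Type*} [Finite ι] {x : ι → 𝓞 K} (hx : x ≠ 0) :
    ∏ᶠ w : FinitePlace L, ⨆ i, w (algebraMap K L (x i)) =
      (∏ᶠ v : FinitePlace K, ⨆ i, v (x i : K)) ^ Module.finrank K L := by
  have hinj : Function.Injective (algebraMap (𝓞 K) (𝓞 L)) := FaithfulSMul.algebraMap_injective _ _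
  have hy : (fun i => algebraMap (𝓞 K) (𝓞 L) (x i)) ≠ 0 := fun h => hx <| funext fun i =>
    hinj ((congrFun h i).trans (map_zero _).symm)
  have hspan : Ideal.span (Set.range fun i => algebraMap (𝓞 K) (𝓞 L) (x i)) =
      (Ideal.span (Set.range x)).map (algebraMap (𝓞 K) (𝓞 L)) := by
    rw [Ideal.map_span, ← Set.range_comp]
    rfl
  have hL := absNorm_mul_finprod_finitePlace_eq_one hy
  have hK := absNorm_mul_finprod_finitePlace_eq_one hx
  rw [hspan, Ideal.absNorm_algebraMap, 
    ← IsFractionRing.finrank_eq (𝓞 K) K (𝓞 L) L] at hL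
  push_cast at hL
  have hK' := congrArg (· ^ Module.finrank K L) hK
  simp only [mul_pow, one_pow] at hK'
  exact mul_left_cancel₀ (left_ne_zero_of_mul_eq_one hK') (hL.trans hK'.symm)

variable {K} in
theorem prod_infinitePlace_iSup_eq_prod_embeddings {ι : Type*} (x : ι → K) :
    ∏ v : InfinitePlace K, (⨆ i, v (x i)) ^ v.mult = ∏ φ : K →+* ℂ, ⨆ i, ‖φ (x i)‖ := by
  classical
  rw [← Finset.prod_fiberwise Finset.univ InfinitePlace.mk]
  refine Finset.prod_congr rfl fun v _ => ?_
  have (φ) (hφ : φ ∈ ({φ | InfinitePlace.mk φ = v} : Finset (K →+* ℂ))) :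
      ⨆ i, ‖φ (x i)‖ = ⨆ i, v (x i) := by
    simp_rw [← (Finset.mem_filter.mp hφ).2, InfinitePlace.apply]
  rw [Finset.prod_congr rfl this, Finset.prod_const, InfinitePlace.card_filter_mk_eq]

theorem prod_embeddings_comp_algebraMap (F : (K →+* ℂ) → ℝ) :
    ∏ ψ : L →+* ℂ, F (ψ.comp (algebraMap K L)) = ∏ φ : K →+* ℂ, F φ ^ Module.finrank K L := by
  classical
  rw [← Finset.prod_fiberwise Finset.univ fun ψ : L →+* ℂ => ψ.comp (algebraMap K L)]
  refine Finset.prod_congr rfl fun φ _ => ?_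
  rw [Finset.prod_congr rfl (g := fun _ => F φ) fun ψ hψ => by rw [(Finset.mem_filter.mp hψ).2],
    Finset.prod_const]
  congr 1
  let := φ.toAlgebra
  rw [← AlgHom.card K L ℂ, ← Fintype.card_coe]
  refine Fintype.card_congr
    { toFun := fun ψ => { (ψ : L →+* ℂ) with
        commutes' := fun r => RingHom.congr_fun (Finset.mem_filter.mp ψ.2).2 r }
      invFun := fun ψ => ⟨ψ.toRingHom, Finset.mem_filter.mpr ⟨Finset.mem_univ _, ψ.comp_algebraMap⟩⟩
      left_inv := fun _ => rfl
      right_inv := fun _ => rfl }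

/-- Independence of the height of the field, up to normalization. At the finite places this is
the behaviour of ideal norms under extension, and at the infinite places it is the fact that
every complex embedding of `K` has `[L : K]` extensions to `L`. -/
theorem mulHeight₁_algebraMap (x : K) :
    mulHeight₁ (algebraMap K L x) = mulHeight₁ x ^ Module.finrank K L := by
  obtain ⟨n, hn, a, ha, -⟩ := exists_nat_ne_zero_exists_integer_mul_eq_and_absNorm_span_eq_pow x
  have hx : x = (a : K) / (n : K) := by
    rw [← ha, mul_div_cancel_left₀ x (by exact_mod_cast hn)]
  let y : Fin 2 → 𝓞 K := ![a, n]
  have hy0 : y ≠ 0 := fun h => by simpa [y, hn] using congrFun h 1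
  have hyK : ![(a : K), (n : K)] = fun i => (y i : K) := by
    ext i; fin_cases i <;> simp [y]
  have hyL : ![algebraMap K L a, algebraMap K L n] = fun i => algebraMap K L (y i) := by
    ext i; fin_cases i <;> simp [y]
  have hyK0 : (fun i => (y i : K)) ≠ 0 := fun h => hy0 <| funext fun i =>
    RingOfIntegers.ext (congrFun h i)
  have hyL0 : (fun i => algebraMap K L (y i)) ≠ 0 := fun h => hyK0 <| funext fun i =>
    (algebraMap K L).injective ((congrFun h i).trans (map_zero _).symm)
  rw [hx, map_div₀, mulHeight₁_div_eq_mulHeight, mulHeight₁_div_eq_mulHeight, hyK, hyL,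
    NumberField.mulHeight_eq hyK0, NumberField.mulHeight_eq hyL0,
    finprod_finitePlace_algebraMap K L hy0, mul_pow,
    prod_infinitePlace_iSup_eq_prod_embeddings, prod_infinitePlace_iSup_eq_prod_embeddings,
    ← Finset.prod_pow,
    ← prod_embeddings_comp_algebraMap K L (fun φ : K →+* ℂ => ⨆ i, ‖φ (y i)‖)]
  rfl

end HeightExtension

/-! ### Properties of the absolute height -/

section AbsoluteHeight

variable {Ω : Type*} [Field Ω] [CharZero Ω]

/-- The absolute height of an algebraic number may be computed in any number field, via any
embedding. -/
theorem absLogHeight₁_algHom {K : Type*} [Field K] [NumberField K] (f : K →ₐ[ℚ] Ω) (x : K) :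
    absLogHeight₁ (f x) = logHeight₁ x / Module.finrank ℚ K := by
  have hint : IsIntegral ℚ (f x) := (Algebra.IsIntegral.isIntegral x).map f
  have : FiniteDimensional ℚ (IntermediateField.adjoin ℚ {f x}) :=
    IntermediateField.adjoin.finiteDimensional hint
  have : NumberField (IntermediateField.adjoin ℚ {f x}) := {}
  have hle : IntermediateField.adjoin ℚ {f x} ≤ f.fieldRange := by simp
  let e := (AlgEquiv.ofInjectiveField f).symm.toAlgHom.comp (IntermediateField.inclusion hle)
  let : Algebra (IntermediateField.adjoin ℚ {f x}) K := e.toRingHom.toAlgebra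
  have hgen : algebraMap (IntermediateField.adjoin ℚ {f x}) K
      (IntermediateField.AdjoinSimple.gen ℚ (f x)) = x :=
    (AlgEquiv.ofInjectiveField f).symm_apply_apply x
  have hdeg := Module.finrank_mul_finrank ℚ (IntermediateField.adjoin ℚ {f x}) K
  have hpos : 0 < Module.finrank (IntermediateField.adjoin ℚ {f x}) K := Module.finrank_pos
  have hlog : Real.log (mulHeight₁ x) = Module.finrank (IntermediateField.adjoin ℚ {f x}) K *
      Real.log (mulHeight₁ (IntermediateField.AdjoinSimple.gen ℚ (f x))) := by
    rw [← Real.log_pow, ← mulHeight₁_algebraMap, hgen]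
  rw [absLogHeight₁, absMulHeight₁, dif_pos hint, Real.log_rpow (by positivity), ← hdeg,
    logHeight₁_eq_log_mulHeight₁, hlog]
  push_cast
  field_simp

theorem absLogHeight₁_coe (L : IntermediateField ℚ Ω) [FiniteDimensional ℚ L] (x : L) :
    letI : NumberField L := {}
    absLogHeight₁ (x : Ω) = logHeight₁ x / Module.finrank ℚ L :=
  letI : NumberField L := {}
  absLogHeight₁_algHom L.val x

section WeilHeight

variable [Algebra.IsIntegral ℚ Ω]

open IntermediateField in
theorem exists_finiteDimensional_intermediateField (a b : Ω) :
    ∃ L : IntermediateField ℚ Ω, FiniteDimensional ℚ L ∧ a ∈ L ∧ b ∈ L :=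
  ⟨adjoin ℚ {a, b}, finiteDimensional_adjoin fun _ _ => Algebra.IsIntegral.isIntegral _,
    subset_adjoin _ _ (by simp), subset_adjoin _ _ (by simp)⟩

theorem weilHeight_nonneg (a : Ωˣ) : 0 ≤ weilHeight a := by
  obtain ⟨L, hL, ha, -⟩ := exists_finiteDimensional_intermediateField (a : Ω) a
  have : NumberField L := {}
  rw [weilHeight, absLogHeight₁_coe L ⟨a, ha⟩]
  positivity

theorem weilHeight_mul_le (a b : Ωˣ) : weilHeight (a * b) ≤ weilHeight a + weilHeight b := by
  obtain ⟨L, hL, ha, hb⟩ := exists_finiteDimensional_intermediateField (a : Ω) b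
  have : NumberField L := {}
  rw [weilHeight, weilHeight, weilHeight, Units.val_mul, absLogHeight₁_coe L ⟨a, ha⟩,
    absLogHeight₁_coe L ⟨b, hb⟩,
    show (a * b : Ω) = ((⟨a, ha⟩ * ⟨b, hb⟩ : L) : Ω) from rfl, absLogHeight₁_coe, ← add_div]
  gcongr
  exact logHeight₁_mul_le _ _

theorem weilHeight_pow (a : Ωˣ) (n : ℕ) : weilHeight (a ^ n) = n * weilHeight a := by
  obtain ⟨L, hL, ha, -⟩ := exists_finiteDimensional_intermediateField (a : Ω) a
  have : NumberField L := {}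
  rw [weilHeight, weilHeight, Units.val_pow_eq_pow_val, absLogHeight₁_coe L ⟨a, ha⟩,
    show (a ^ n : Ω) = ((⟨a, ha⟩ ^ n : L) : Ω) from rfl, absLogHeight₁_coe, logHeight₁_pow,
    mul_div_assoc]

theorem weilHeight_inv (a : Ωˣ) : weilHeight a⁻¹ = weilHeight a := by
  obtain ⟨L, hL, ha, -⟩ := exists_finiteDimensional_intermediateField (a : Ω) a
  have : NumberField L := {}
  rw [weilHeight, weilHeight, Units.val_inv_eq_inv_val, absLogHeight₁_coe L ⟨a, ha⟩,
    show (a : Ω)⁻¹ = ((⟨a, ha⟩⁻¹ : L) : Ω) from rfl, absLogHeight₁_coe, logHeight₁_inv]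

theorem weilHeight_map_algEquiv (σ : Ω ≃ₐ[ℚ] Ω) (a b : Ωˣ) (h : (b : Ω) = σ a) :
    weilHeight b = weilHeight a := by
  obtain ⟨L, hL, ha, -⟩ := exists_finiteDimensional_intermediateField (a : Ω) a
  have : NumberField L := {}
  rw [weilHeight, weilHeight, absLogHeight₁_coe L ⟨a, ha⟩, h]
  exact absLogHeight₁_algHom (σ.toAlgHom.comp L.val) ⟨a, ha⟩

/-- Kronecker's theorem, by Northcott's: the powers of `a` all have height zero, so that only
finitely many of them are distinct. -/
theorem isOfFinOrder_of_weilHeight_eq_zero {a : Ωˣ} (h : weilHeight a = 0) : IsOfFinOrder a := by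
  obtain ⟨L, hL, ha, -⟩ := exists_finiteDimensional_intermediateField (a : Ω) a
  have : NumberField L := {}
  rw [weilHeight, absLogHeight₁_coe L ⟨a, ha⟩] at h
  have hpos : (Module.finrank ℚ L : ℝ) ≠ 0 := by exact_mod_cast Module.finrank_pos.ne'
  have h0 : logHeight₁ (⟨a, ha⟩ : L) = 0 := by simpa [hpos] using h
  have hfin := finite_setOfPred_logHeight₁_le L 0
  obtain ⟨m, n, hmn, heq⟩ := Set.Finite.exists_lt_map_eq_of_forall_mem
    (f := fun n : ℕ => (⟨a, ha⟩ : L) ^ n) (t := {x : L | logHeight₁ x ≤ 0})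
    (fun n => by rw [Set.mem_ofPred_eq, logHeight₁_pow, h0, mul_zero]) hfin
  have heq' : a ^ m = a ^ n := Units.ext (by simpa using congrArg Subtype.val heq)
  refine isOfFinOrder_iff_pow_eq_one.mpr ⟨n - m, by omega, ?_⟩
  rw [pow_sub a hmn.le, heq', mul_inv_cancel]

end WeilHeight

end AbsoluteHeight

/-! ### Passage to the divisible hull -/

section Hull

variable {G A : Type*} [Group G] [CommGroup A] [MulDistribMulAction G A]

/-- The action of `G` on the divisible hull of `A`, by acting on numerators. -/
@[reducible]
noncomputable def divisibleHullAction : DistribMulAction G (DivisibleHull (Additive A)) where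
  smul g x := x.liftOn (fun m s => .mk ((MulDistribMulAction.toMonoidHom A g).toAdditive m) s)
    fun m m' s s' h => by
      obtain ⟨u, hu⟩ := DivisibleHull.mk_eq_mk.mp h
      refine DivisibleHull.mk_eq_mk.mpr ⟨u, ?_⟩
      rw [← map_nsmul, ← map_nsmul, hu, map_nsmul, map_nsmul]
  one_smul x := by
    induction x with | mk m s
    exact congrArg (DivisibleHull.mk · s) (congrArg Additive.ofMul (one_smul G m.toMul))
  mul_smul g h x := by
    induction x with | mk m s
    exact congrArg (DivisibleHull.mk · s) (congrArg Additive.ofMul (mul_smul g h m.toMul))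
  smul_zero g := by
    rw [← DivisibleHull.mk_zero 1]
    exact congrArg (DivisibleHull.mk · 1)
      (map_zero (MulDistribMulAction.toMonoidHom A g).toAdditive)
  smul_add g x y := by
    induction x with | mk m s
    induction y with | mk n t
    rw [DivisibleHull.mk_add_mk]
    change DivisibleHull.mk ((MulDistribMulAction.toMonoidHom A g).toAdditive _) _ =
      DivisibleHull.mk ((MulDistribMulAction.toMonoidHom A g).toAdditive m) s +
      DivisibleHull.mk ((MulDistribMulAction.toMonoidHom A g).toAdditive n) t
    rw [DivisibleHull.mk_add_mk, map_add, map_nsmul, map_nsmul]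
    rfl

attribute [local instance] divisibleHullAction

theorem finite_orbit_divisibleHull (hfin : ∀ a : A, Finite (orbit G a))
    (x : DivisibleHull (Additive A)) : Finite (orbit G x) := by
  induction x with | mk m s
  have : (orbit G m.toMul).Finite := hfin m.toMul
  refine (this.image fun a => DivisibleHull.mk (Additive.ofMul a) s).subset ?_
  rintro _ ⟨g, rfl⟩
  exact ⟨g • m.toMul, ⟨g, rfl⟩, rfl⟩

/-- The extension to the divisible hull of a height-like function `h` on `A`: the fraction `a / s`
gets the value `h a / s`. -/
noncomputable def divisibleHullSeminorm (h : A → ℝ) (hmul : ∀ a b, h (a * b) ≤ h a + h b)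
    (hpow : ∀ a (n : ℕ), h (a ^ n) = n * h a) (hinv : ∀ a, h a⁻¹ = h a) :
    Seminorm ℚ (DivisibleHull (Additive A)) :=
  Seminorm.of
    (fun x => x.liftOn (fun m s => h m.toMul / s) fun m m' s s' hms => by
      obtain ⟨u, hu⟩ := DivisibleHull.mk_eq_mk.mp hms
      have := congrArg (fun z : Additive A => h z.toMul) hu
      simp only [toMul_nsmul, hpow] at this
      have hu0 : (u.val : ℝ) ≠ 0 := by exact_mod_cast u.ne_zero
      have hs0 : (s.val : ℝ) ≠ 0 := by exact_mod_cast s.ne_zero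
      have hs0' : (s'.val : ℝ) ≠ 0 := by exact_mod_cast s'.ne_zero
      rw [div_eq_div_iff hs0 hs0']
      linarith [mul_left_cancel₀ hu0 this])
    (fun x y => by
      induction x with | mk m s
      induction y with | mk n t
      rw [DivisibleHull.mk_add_mk]
      simp only [DivisibleHull.liftOn_mk, toMul_add, toMul_nsmul]
      have hs0 : (0 : ℝ) < s.val := by exact_mod_cast s.pos
      have ht0 : (0 : ℝ) < t.val := by exact_mod_cast t.pos
      have h1 := hmul (m.toMul ^ t.val) (n.toMul ^ s.val)
      rw [hpow, hpow] at h1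
      rw [div_add_div _ _ hs0.ne' ht0.ne', PNat.mul_coe, Nat.cast_mul]
      gcongr
      linarith)
    (fun q x => by
      induction x with | mk m s
      have hzpow : ∀ a (n : ℤ), h (a ^ n) = |(n : ℝ)| * h a := by
        intro a n
        obtain ⟨k, rfl | rfl⟩ := n.eq_nat_or_neg <;> simp [hpow, hinv]
      rw [DivisibleHull.qsmul_mk]
      simp only [DivisibleHull.liftOn_mk, toMul_zsmul, hzpow]
      have hq : ‖q‖ = |(q.num : ℝ)| / q.den := by
        rw [← Rat.norm_cast_real, Real.norm_eq_abs]
        conv_lhs => rw [Rat.cast_def, abs_div, Nat.abs_cast]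
      let d : ℕ+ := ⟨q.den, q.den_pos⟩
      have hden : (((d * s : ℕ+) : ℕ) : ℝ) = q.den * s.val := by
        rw [PNat.mul_coe, Nat.cast_mul]
        rfl
      rw [hq]
      exact (congrArg (_ / ·) hden).trans (mul_div_mul_comm _ _ _ _))

/-- An `H`-invariant element of the hull has a multiple that comes from an `H`-invariant of `A`. If
`m / s` is invariant then `g • m` and `m` differ by torsion for each `g`, and as the orbit is finite
one exponent kills all these differences. -/
theorem exists_nsmul_eq_coe_of_mem_invariantSubspace (hfin : ∀ a : A, Finite (orbit G a))
    (H : Subgroup G) {x : DivisibleHull (Additive A)}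
    (hx : x ∈ invariantSubspace (DivisibleHull (Additive A)) H) :
    ∃ n : ℕ, n ≠ 0 ∧ ∃ a ∈ FixedPoints.subgroup H A,
      n • x = DivisibleHull.mk (Additive.ofMul a) 1 := by
  induction x with | mk m s
  have htor : ∀ b : orbit H m.toMul, ∃ u : ℕ, u ≠ 0 ∧ (b : A) ^ u = m.toMul ^ u := by
    rintro ⟨_, g, rfl⟩
    obtain ⟨u, hu⟩ := DivisibleHull.mk_eq_mk.mp (hx g g.2)
    refine ⟨u.val * s.val, mul_ne_zero u.ne_zero s.ne_zero, ?_⟩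
    rw [mul_comm, pow_mul, pow_mul]
    exact congrArg Additive.toMul hu
  choose u hu0 hu using htor
  have : Finite (orbit H m.toMul) := by
    have := hfin m.toMul
    exact Finite.Set.subset (orbit G m.toMul) (by rintro _ ⟨g, rfl⟩; exact ⟨(g : G), rfl⟩)
  let := Fintype.ofFinite (orbit H m.toMul)
  set U := ∏ b, u b
  have hU0 : U ≠ 0 := Finset.prod_ne_zero_iff.mpr fun b _ => hu0 b
  refine ⟨U * s.val, mul_ne_zero hU0 s.ne_zero, m.toMul ^ U, fun g => ?_, ?_⟩
  · obtain ⟨k, hk⟩ : u ⟨g • m.toMul, mem_orbit _ _⟩ ∣ U :=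
      Finset.dvd_prod_of_mem _ (Finset.mem_univ _)
    have := hu ⟨g • m.toMul, mem_orbit _ _⟩
    rw [smul_pow', hk, pow_mul, this, pow_mul]
  · rw [DivisibleHull.nsmul_mk, DivisibleHull.mk_eq_mk]
    refine ⟨1, ?_⟩
    simp [ofMul_pow, mul_smul, smul_comm U s.val]

/-- The closure theorem for invariants, pulled back from the divisible hull to the group itself.
Let `G` act on an abelian group `A` with finite orbits, preserving a height-like function `h`
that vanishes only on torsion. For finitely many subgroups of `G` of each two of which one
normalizes the other, the group of elements of which a power is in the product of their groups
of invariants is closed. -/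
theorem exists_pow_mem_iSup_fixedPoints_of_approx (h : A → ℝ)
    (hmul : ∀ a b, h (a * b) ≤ h a + h b)
    (hpow : ∀ a (n : ℕ), h (a ^ n) = n * h a) (hinv : ∀ a, h a⁻¹ = h a)
    (hsmul : ∀ (g : G) a, h (g • a) = h a) (hzero : ∀ a, h a = 0 → IsOfFinOrder a)
    (hfin : ∀ a : A, Finite (orbit G a)) {ι : Type*} [Fintype ι] (H : ι → Subgroup G)
    (hH : ∀ i j, i ≠ j → (∀ g ∈ H i, ∀ h ∈ H j, g * h * g⁻¹ ∈ H j) ∨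
      (∀ g ∈ H j, ∀ h ∈ H i, g * h * g⁻¹ ∈ H i))
    (a : A) (ha : ∀ ε > 0, ∃ b, (∃ n : ℕ, n ≠ 0 ∧ b ^ n ∈ ⨆ i, FixedPoints.subgroup (H i) A) ∧
      h (a / b) < ε) :
    ∃ n : ℕ, n ≠ 0 ∧ a ^ n ∈ ⨆ i, FixedPoints.subgroup (H i) A := by
  let c : A → DivisibleHull (Additive A) := fun a => DivisibleHull.mk (Additive.ofMul a) 1
  let N := divisibleHullSeminorm h hmul hpow hinv
  have hN : ∀ a, N (c a) = h a := fun a => by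
    change h a / ((1 : ℕ+) : ℕ) = h a
    simp
  have hc_mul : ∀ a b, c (a * b) = c a + c b := fun a b => DivisibleHull.coe_add
  have hc_pow : ∀ a (n : ℕ), c (a ^ n) = n • c a := fun a n => (DivisibleHull.nsmul_mk n _ 1).symm
  have hc_eq : ∀ a b, c a = c b → ∃ n : ℕ, n ≠ 0 ∧ a ^ n = b ^ n := fun a b hab => by
    obtain ⟨u, hu⟩ := DivisibleHull.mk_eq_mk.mp hab
    exact ⟨u, u.ne_zero, by simpa using congrArg Additive.toMul hu⟩
  set S := ⨆ i, invariantSubspace (DivisibleHull (Additive A)) (H i)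
  -- Invariants of `A` give invariants of the hull.
  have hmem : ∀ b ∈ ⨆ i, FixedPoints.subgroup (H i) A, c b ∈ S := by
    intro b hb
    refine Subgroup.iSup_induction _ (C := fun b => c b ∈ S) hb ?_ ?_ ?_
    · intro i b hb
      refine Submodule.mem_iSup_of_mem i fun g hg => ?_
      exact congrArg c (hb ⟨g, hg⟩)
    · change DivisibleHull.mk (0 : Additive A) 1 ∈ S
      rw [DivisibleHull.mk_zero]
      exact zero_mem _
    · intro x y hx hy
      rw [hc_mul]
      exact add_mem hx hy
  -- Conversely, every element of `S` has a multiple that comes from `A`.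
  have hmem' : ∀ x ∈ S, ∃ n : ℕ, n ≠ 0 ∧ ∃ b ∈ ⨆ i, FixedPoints.subgroup (H i) A, n • x = c b := by
    intro x hx
    refine Submodule.iSup_induction _ (motive := fun x => ∃ n : ℕ, n ≠ 0 ∧
      ∃ b ∈ ⨆ i, FixedPoints.subgroup (H i) A, n • x = c b) hx ?_ ?_ ?_
    · intro i x hx
      obtain ⟨n, hn, b, hb, hnb⟩ := exists_nsmul_eq_coe_of_mem_invariantSubspace hfin (H i) hx
      exact ⟨n, hn, b, Subgroup.mem_iSup_of_mem i hb, hnb⟩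
    · refine ⟨1, one_ne_zero, 1, one_mem _, ?_⟩
      rw [nsmul_zero]
      exact (DivisibleHull.mk_zero 1).symm
    · rintro x y ⟨n, hn, b, hb, hnb⟩ ⟨m, hm, d, hd, hmd⟩
      refine ⟨n * m, mul_ne_zero hn hm, b ^ m * d ^ n, mul_mem (pow_mem hb m) (pow_mem hd n), ?_⟩
      rw [hc_mul, hc_pow, hc_pow, ← hnb, ← hmd, nsmul_add, mul_nsmul, mul_nsmul']
  have haS : c a ∈ S := by
    refine mem_iSup_invariantSubspace_of_approx N ?_ ?_ (finite_orbit_divisibleHull hfin) H hH _ ?_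
    · intro x hx
      induction x with | mk m s
      have hs0 : (s.val : ℝ) ≠ 0 := by exact_mod_cast s.ne_zero
      have h0 : h m.toMul = 0 := (div_eq_zero_iff.mp hx).resolve_right hs0
      obtain ⟨n, hn, hmn⟩ := isOfFinOrder_iff_pow_eq_one.mp (hzero _ h0)
      rw [← DivisibleHull.mk_zero 1, DivisibleHull.mk_eq_mk]
      refine ⟨⟨n, hn⟩, ?_⟩
      simpa using (congrArg Additive.ofMul hmn : n • m = 0)
    · intro g x
      induction x with | mk m s
      exact congrArg (· / (s.val : ℝ)) (hsmul g m.toMul)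
    · intro ε hε
      obtain ⟨b, ⟨n, hn, hb⟩, hlt⟩ := ha ε hε
      refine ⟨c b, ?_, ?_⟩
      · have := hmem _ hb
        rw [hc_pow, ← Nat.cast_smul_eq_nsmul ℚ] at this
        exact (Submodule.smul_mem_iff _ (by exact_mod_cast hn)).mp this
      · have : c a - c b = c (a / b) := by
          rw [sub_eq_iff_eq_add, ← hc_mul, div_mul_cancel]
        rwa [this, hN]
  obtain ⟨n, hn, b, hb, hnb⟩ := hmem' _ haS
  rw [← hc_pow] at hnb
  obtain ⟨m, hm, heq⟩ := hc_eq _ _ hnb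
  exact ⟨n * m, mul_ne_zero hn hm, by rw [pow_mul, heq]; exact pow_mem hb m⟩

end Hull

/-! ### Galois theory of the fields `K n` -/

section Galois

variable {Ω : Type*} [Field Ω] [CharZero Ω]

open IntermediateField

/-- If `K / K ∩ L` is Galois, then `K` is stable under the automorphisms that fix `L`, so that
these normalize the group of automorphisms that fix `K`. -/
theorem IsGaloisOverInter.conj_mem_fixingSubgroup [Normal ℚ Ω] {K L : IntermediateField ℚ Ω}
    (hKL : IsGaloisOverInter K L) {σ τ : Ω ≃ₐ[ℚ] Ω} (hσ : σ ∈ L.fixingSubgroup)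
    (hτ : τ ∈ K.fixingSubgroup) : σ * τ * σ⁻¹ ∈ K.fixingSubgroup := by
  have hstable : ∀ ρ ∈ L.fixingSubgroup, ∀ x ∈ K, ρ x ∈ K := by
    intro ρ hρ x hx
    have hρ' : ρ ∈ (K ⊓ L).fixingSubgroup := fixingSubgroup_antitone inf_le_right hρ
    have hnormal : Normal ↥(K ⊓ L) ↥(extendScalars (inf_le_left : K ⊓ L ≤ K)) := hKL.to_normal
    have : Normal ↥(K ⊓ L) Ω := Normal.tower_top_of_normal ℚ _ _
    exact normal_iff_forall_map_le.mp hnormal (fixingSubgroupEquiv (K ⊓ L) ⟨ρ, hρ'⟩).toAlgHom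
      ⟨x, hx, rfl⟩
  rw [IntermediateField.mem_fixingSubgroup_iff] at hτ ⊢
  intro x hx
  have := hτ _ (hstable σ⁻¹ (inv_mem hσ) x hx)
  rw [AlgEquiv.mul_apply, AlgEquiv.mul_apply, this]
  exact σ.apply_symm_apply x

theorem mem_fixedPoints_fixingSubgroup_iff [IsGalois ℚ Ω] (K : IntermediateField ℚ Ω) (a : Ωˣ) :
    a ∈ FixedPoints.subgroup K.fixingSubgroup Ωˣ ↔ (a : Ω) ∈ K := by
  conv_rhs => rw [← InfiniteGalois.fixedField_fixingSubgroup K, mem_fixedField_iff]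
  constructor
  · exact fun h σ hσ => congrArg Units.val (h ⟨σ, hσ⟩)
  · exact fun h σ => Units.ext (h σ σ.2)

/-- The Galois invariants reconstruct the product of the multiplicative groups of the `K n`, by
the Galois correspondence for the infinite extension `Ω / ℚ`. -/
theorem iSup_fixedPoints_fixingSubgroup [IsGalois ℚ Ω] {N : ℕ}
    (K : Fin N → IntermediateField ℚ Ω) :
    ⨆ n, FixedPoints.subgroup (K n).fixingSubgroup Ωˣ = unitsProduct K := by
  refine le_antisymm (iSup_le fun n a ha => ?_) ?_
  · rw [mem_fixedPoints_fixingSubgroup_iff] at ha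
    refine ⟨Pi.mulSingle n a, fun m => ?_, by simp⟩
    obtain rfl | hmn := eq_or_ne m n
    · simpa using ha
    · simp [hmn]
  · rintro _ ⟨β, hβ, rfl⟩
    exact prod_mem fun n _ => Subgroup.mem_iSup_of_mem n
      ((mem_fixedPoints_fixingSubgroup_iff (K n) (β n)).mpr (hβ n))

theorem mem_divClosure_iff_exists_pow {Ω : Type*} [Field Ω] (G : Subgroup Ωˣ) (a : Ωˣ) :
    a ∈ divClosure G ↔ ∃ n : ℕ, n ≠ 0 ∧ a ^ n ∈ G := by
  constructor
  · rintro ⟨m, hm, h⟩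
    refine ⟨m.natAbs, Int.natAbs_ne_zero.mpr hm, ?_⟩
    obtain h' | h' := m.natAbs_eq
    · rwa [h', zpow_natCast] at h
    · rw [h', zpow_neg, zpow_natCast] at h
      exact inv_mem_iff.mp h
  · rintro ⟨n, hn, h⟩
    exact ⟨n, by exact_mod_cast hn, by simpa using h⟩

theorem finite_orbit_units [Algebra.IsIntegral ℚ Ω] (a : Ωˣ) : Finite (orbit (Ω ≃ₐ[ℚ] Ω) a) := by
  have hne : minpoly ℚ (a : Ω) ≠ 0 := minpoly.ne_zero (Algebra.IsIntegral.isIntegral _)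
  refine Set.Finite.of_finite_image (f := Units.val)
    (((minpoly ℚ (a : Ω)).rootSet_finite Ω).subset ?_) Units.val_injective.injOn
  rintro _ ⟨_, ⟨σ, rfl⟩, rfl⟩
  rw [Polynomial.mem_rootSet_of_ne hne]
  change Polynomial.aeval (σ (a : Ω)) _ = 0
  rw [Polynomial.aeval_algHom_apply, minpoly.aeval, map_zero]

end Galois

/-! ### The closedness of `Γ` -/

theorem theorem1p3 {QBar : Type*} [Field QBar] [CharZero QBar] [IsAlgClosure ℚ QBar]
    (N : ℕ) (K : Fin N → IntermediateField ℚ QBar)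
    (hK : ∀ n₁ n₂ : Fin N, n₁ ≠ n₂ →
      IsGaloisOverInter (K n₁) (K n₂) ∨ IsGaloisOverInter (K n₂) (K n₁))
    (α : QBarˣ) :
    relHeight (divClosure (unitsProduct K)) α = 0 ↔ α ∈ divClosure (unitsProduct K) := by
  have : Algebra.IsAlgebraic ℚ QBar := IsAlgClosure.isAlgebraic
  have : IsAlgClosed QBar := IsAlgClosure.isAlgClosed ℚ
  have : IsGalois ℚ QBar := {}
  have hbdd : BddBelow (Set.range fun γ : divClosure (unitsProduct K) =>
      weilHeight (α / (γ : QBarˣ))) := ⟨0, by rintro _ ⟨γ, rfl⟩; exact weilHeight_nonneg _⟩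
  constructor
  · intro h0
    rw [mem_divClosure_iff_exists_pow, ← iSup_fixedPoints_fixingSubgroup]
    refine exists_pow_mem_iSup_fixedPoints_of_approx (G := QBar ≃ₐ[ℚ] QBar) weilHeight
      weilHeight_mul_le weilHeight_pow weilHeight_inv
      (fun σ a => weilHeight_map_algEquiv σ a _ rfl)
      (fun a => isOfFinOrder_of_weilHeight_eq_zero) finite_orbit_units
      (fun n => (K n).fixingSubgroup) ?_ α ?_
    · intro i j hij
      exact (hK i j hij).symm.imp (fun h σ hσ τ hτ => h.conj_mem_fixingSubgroup hσ hτ)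
        (fun h σ hσ τ hτ => h.conj_mem_fixingSubgroup hσ hτ)
    · intro ε hε
      have hlt : relHeight (divClosure (unitsProduct K)) α < ε := h0 ▸ hε
      obtain ⟨γ, hγ⟩ := exists_lt_of_ciInf_lt hlt
      refine ⟨γ, ?_, hγ⟩
      rw [iSup_fixedPoints_fixingSubgroup, ← mem_divClosure_iff_exists_pow]
      exact γ.2
  · -- The choice `γ = α` gives height `h 1 = 0`.
    intro h
    refine le_antisymm ((ciInf_le hbdd ⟨α, h⟩).trans_eq ?_)
      (Real.iInf_nonneg fun _ => weilHeight_nonneg _)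
    simpa using weilHeight_pow (1 : QBarˣ) 0
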